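/- **Machines.** A general machine is a finite set of configurations, each a tuple $(w,m,o)$ of a work, a metadata and an output register, with a function $f$ that maps each configuration to its set of successors; a configuration without successor is terminal. The machine is reversible if every configuration has at most one successor and at most one predecessor. A physical embedding of a machine assigns a free energy $\Delta G_U$ to each configuration $U$; it evolves as the continuous-time Markov process that jumps from $U$ to $V\neq U$, whenever $V\in f(U)$ or $U\in f(V)$, at the Metropolis rate $k\,e^{-(\Delta G_V-\Delta G_U)/\theta}$ if $\Delta G_U<\Delta G_V$ and $k$ otherwise, where $k>0$ is the rate constant and $\theta>0$ the thermal energy. It is adiabatic if all free energies are equal. **Monte Carlo samplers.** Let the metadata be in $\{0,1\}$ and let the output register hold two values. The observer starts the process in any configuration and repeatedly waits and then measures, recording the first output value if the metadata is $0$ and the second one if it is $1$. The embedding is a $(\tau,\epsilon)$-efficient Monte Carlo sampler for a distribution $\mathcal D$ if for every real $c\ge 1$, whatever positive times were waited before the earlier measurements and conditioned on any values (of positive probability) recorded at them, the value recorded after waiting a further time $c\tau$ has a law $\mathcal D'$ with total variation distance at most $\epsilon^{c}$ from $\mathcal D$. **Construction.** Let $M$ be a reversible general machine, $T,r\in\mathbb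 N$, and let $g:\{0,1\}^r\to Y$ map a uniformly random string to a sample from the distribution $\mathcal D$ on the finite set $Y$. Suppose that for every $b\in\{0,1\}^r$, started from the configuration for input $b$, $M$ halts with output $g(b)$ after visiting a chain of at most $T$ configurations (including the first and the last). Elongate the chain of each $b$ to exactly $T$ nodes by repeating the registers of its terminal configuration (with distinct labels), and append $T+r+1$ further such nodes, the output holding region. The sub-machine $M_s$, $s\in\{1,-1\}$, has layers $0,\dots,2T+2r+1$. Layers $0,\dots,r$ form the randomizer: each contains one node for each string in $\{0,1\}^{r+1}$, and a node of layer $i<r$ is joined to the nodes of layer $i+1$ whose string agrees with its own except possibly in bit $i$ (bits are numbered $0,\dots,r$). Layers $r+1,\dots,2T+2r+1$ consist of two copies of the elongated chain of each $b$; the first nodes of both copies are joined to the two nodes of layer $r$ whose string starts with $b$, and each chain node is joined to the next node in both copies. The metadata is $s$ in the output holding region and $0$ elsewhere; in the randomizer the output register is blank. The machine $M^*$ has as nodes the pairs of a node of $M_1$ in some layer $i$ and a node of $M_{-1}$ in layer $2T+2r+1-i$; in each step $M_1$ moves one edge forwards and $M_{-1}$ one edge backwards. Its output register is the pair of the two output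 registers, and its metadata bit is $0$ if the sum $m_1+m_{-1}$ of the two metadata values is $1$, and $1$ otherwise. **Theorem.** The sum $m_1+m_{-1}$ is $1$ or $-1$ at every node of $M^*$. There are absolute constants $a,b>0$ and a function $\tau$ with $a(T^2+r^2)\le\tau(T,r)\le b(T^2+r^2)$ for all $T,r$ such that for all $M$, $T$, $r$, $g$, $\mathcal D$ as above, $M^*$ has an adiabatic physical embedding, and every adiabatic physical embedding of $M^*$, with rate constant $k$, is a $(\tau(T,r)/k,\,1/2)$-efficient Monte Carlo sampler for $\mathcal D$. -/

import Mathlib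

/-- A general machine on a finite configuration space `C`: every configuration is a tuple
`(w, m, o)` of a work, a metadata and an output register (so it is determined by the three
registers), and `next x` is the set of successor configurations of `x`. -/
structure GeneralMachine (C W Mt O : Type*) where
  work : C → W
  mdata : C → Mt
  out : C → O
  registers_injective : Function.Injective fun x => (work x, mdata x, out x)
  next : C → Set C

namespace GeneralMachine

variable {C W Mt O : Type*} (M : GeneralMachine C W Mt O)

/-- A terminal configuration has no successor. -/
def IsTerminal (x : C) : Prop := M.next x = ∅

/-- Every configuration has at most one successor. -/
def IsDeterministic : Prop := ∀ x, (M.next x).Subsingleton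

/-- Every configuration has at most one successor and at most one predecessor. -/
def IsReversible : Prop :=
  M.IsDeterministic ∧ ∀ x x' y, y ∈ M.next x → y ∈ M.next x' → x = x'

open Classical in
/-- One time step of a deterministic machine: go to the (unique) successor; a terminal
configuration is kept. -/
noncomputable def advance (x : C) : C :=
  if h : (M.next x).Nonempty then h.some else x

/-- The configuration of a deterministic machine `t` time steps after `x`. -/
noncomputable def run (x : C) (t : ℕ) : C := M.advance^[t] x

/-- Started in the configuration `init b` that carries the input `b`, the machine halts with output
`g b`, and the chain of configurations from `init b` to the terminal one has at most `T` nodes. -/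
def ComputesWithin {r : ℕ} {Y : Type*} (M : GeneralMachine C W Mt (Option Y))
    (init : (Fin r → Bool) → C) (g : (Fin r → Bool) → Y) (T : ℕ) : Prop :=
  ∀ b, ∃ n < T, M.IsTerminal (M.run (init b) n) ∧ M.out (M.run (init b) n) = some (g b)

end GeneralMachine

/-- `g : {0,1}^r → Y` is a `D`-generator: `g x ∼ D` for uniformly random `x`. -/
def IsGenerator {r : ℕ} {Y : Type*} (g : (Fin r → Bool) → Y) (D : PMF Y) : Prop :=
  (PMF.uniformOfFintype (Fin r → Bool)).map g = D

/-! ### Physical embeddings and their continuous-time dynamics -/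

/-- A physical embedding of `M`: a free energy for every configuration, the rate constant `k` of the
Metropolis dynamics, and the thermal energy (Boltzmann constant times temperature). -/
structure PhysicalEmbedding {C W Mt O : Type*} (M : GeneralMachine C W Mt O) where
  freeEnergy : C → ℝ
  rate : ℝ
  rate_pos : 0 < rate
  thermal : ℝ
  thermal_pos : 0 < thermal

namespace PhysicalEmbedding

variable {C W Mt O : Type*} {M : GeneralMachine C W Mt O} (P : PhysicalEmbedding M)

/-- All configurations have the same free energy. -/
def IsAdiabatic : Prop := ∀ u v, P.freeEnergy u = P.freeEnergy v

/-- The Metropolis rate of the transition `u → v`. -/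
noncomputable def metropolis (u v : C) : ℝ :=
  if P.freeEnergy u < P.freeEnergy v then
    P.rate * (Real.exp (-P.freeEnergy v / P.thermal) / Real.exp (-P.freeEnergy u / P.thermal))
  else P.rate

open Classical in
/-- The jump rate from `u` to `v`: the Metropolis rate if `v` is a successor or a predecessor
of `u`, and `0` otherwise. -/
noncomputable def jumpRate (u v : C) : ℝ :=
  if u ≠ v ∧ (v ∈ M.next u ∨ u ∈ M.next v) then P.metropolis u v else 0

variable [Fintype C] [DecidableEq C]

/-- The generator (rate matrix) of the continuous-time Markov process on the configurations. -/
noncomputable def generator : Matrix C C ℝ :=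
  Matrix.of fun u v => if u = v then -∑ z, P.jumpRate u z else P.jumpRate u v

/-- The transition matrix of the process over a time interval of length `t`: the entry `(u, v)` is
the probability to be in `v` after time `t` when starting in `u`. -/
noncomputable def transition (t : ℝ) : Matrix C C ℝ := NormedSpace.exp (t • P.generator)

/-- The process starts in `x₀` and is looked at `n` times, the `i`-th time after a further
`wait i` time units: the probability that the configurations seen are `x 0, …, x (n - 1)`. -/
noncomputable def pathProb (x₀ : C) (wait : ℕ → ℝ) (n : ℕ) (x : Fin n → C) : ℝ :=
  ∏ i : Fin n, P.transition (wait i) ((Fin.cons x₀ x : Fin (n + 1) → C) i.castSucc) (x i)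

end PhysicalEmbedding

/-! ### Monte Carlo samplers -/

/-- Total variation distance of two distributions on a finite set, given by their weights. -/
noncomputable def tvDist {α : Type*} [Fintype α] (p q : α → ℝ) : ℝ := (∑ a, |p a - q a|) / 2

/-- A distribution on `Y`, seen as one on the contents of an output register that may also be
blank (`none`, with probability `0`). -/
noncomputable def registerLaw {Y : Type*} (D : PMF Y) : Option Y → ℝ
  | none => 0
  | some y => (D y).toReal

section MonteCarlo

variable {C W Y : Type*}

/-- The value that the observer records in configuration `x`: the first value of the output
register if the metadata is `0`, the second one if it is `1`. -/
def GeneralMachine.recorded (M : GeneralMachine C W (Fin 2) (Option Y × Option Y)) (x : C) :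
    Option Y :=
  if M.mdata x = 0 then (M.out x).1 else (M.out x).2

namespace PhysicalEmbedding

variable [Fintype C] [DecidableEq C]
  {M : GeneralMachine C W (Fin 2) (Option Y × Option Y)} (P : PhysicalEmbedding M)

open Classical in
/-- The probability that the first `n` recorded values are `y 0, …, y (n - 1)`. -/
noncomputable def outputsProb (x₀ : C) (wait : ℕ → ℝ) (n : ℕ) (y : Fin n → Option Y) : ℝ :=
  ∑ x : Fin n → C, if ∀ i, M.recorded (x i) = y i then P.pathProb x₀ wait n x else 0

/-- The conditional probability that the next recorded value is `o`, given that the previous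
recorded values are `y`. -/
noncomputable def nextOutputProb (x₀ : C) (wait : ℕ → ℝ) (n : ℕ) (y : Fin n → Option Y)
    (o : Option Y) : ℝ :=
  P.outputsProb x₀ wait (n + 1) (Fin.snoc y o : Fin (n + 1) → Option Y) / P.outputsProb x₀ wait n y

/-- `(τ, ε)`-efficient Monte Carlo sampler for `D`: from every initial configuration, whatever
(positive) multiples of `τ` the observer waits before the earlier measurements and whatever values
were recorded at them, the value recorded after waiting `c n * τ` more time units (at least one full
period) has a conditional law within total variation distance `ε ^ (c n)` of `D`. -/
def IsEfficientMonteCarloSampler [Fintype Y] (D : PMF Y) (τ ε : ℝ) : Prop :=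
  ∀ (x₀ : C) (c : ℕ → ℝ) (n : ℕ) (y : Fin n → Option Y),
    (∀ i, 0 < c i) → 1 ≤ c n →
    0 < P.outputsProb x₀ (fun i => c i * τ) n y →
    tvDist (registerLaw D) (P.nextOutputProb x₀ (fun i => c i * τ) n y) ≤ ε ^ (c n)

end PhysicalEmbedding

end MonteCarlo

/-! ### The layered sub-machine and the product machine -/

/-- Nodes of a sub-machine. Left summand, the randomizer: `(i, u)` is the node in column `i` with
bit string `u` of length `r + 1`. Right summand, the chains: `(b, a, t)` is node `t` in copy `a` of
the elongated chain of input `b`; nodes `0, …, T - 1` are the computation, padded to length `T`,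
and the `T + r + 1` nodes `T, …, 2T + r` form the output holding region. -/
abbrev SubNode (r T : ℕ) : Type :=
  (Fin (r + 1) × (Fin (r + 1) → Bool)) ⊕ ((Fin r → Bool) × Bool × Fin (2 * T + r + 1))

instance (r T : ℕ) : DecidableEq (SubNode r T) := inferInstance

namespace SubNode

variable {r T : ℕ}

/-- The layer of a node, from `0` (leftmost) to `2T + 2r + 1` (rightmost). -/
def layer : SubNode r T → ℕ
  | .inl (i, _) => i
  | .inr (_, _, t) => r + 1 + t

/-- The output holding region. -/
def IsHolding (v : SubNode r T) : Prop := r + 1 + T ≤ layer v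

/-- `Edge v v'`: there is an edge from `v` to the node `v'` one layer further to the right.
In the randomizer, columns `i` and `i + 1` are joined where the strings agree outside bit `i`;
a node of the last column is joined to the first nodes of both copies of the chain whose input is
given by its first `r` bits; a chain node is joined to the following node in both copies. -/
def Edge : SubNode r T → SubNode r T → Prop
  | .inl (i, u), .inl (j, v) => (j : ℕ) = i + 1 ∧ ∀ k, k ≠ i → u k = v k
  | .inl (i, u), .inr (b, _, t) => (i : ℕ) = r ∧ (t : ℕ) = 0 ∧ ∀ k : Fin r, u k.castSucc = b k
  | .inr (b, _, t), .inr (b', _, t') => b = b' ∧ (t' : ℕ) = t + 1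
  | .inr _, .inl _ => False

end SubNode

section Construction

variable {C W Mt Y : Type*} {r : ℕ}

/-- The work register of a sub-machine: the label of the node, together with the work and metadata
registers of the original machine on chain nodes. -/
abbrev SubWork (W Mt : Type*) (r T : ℕ) : Type _ := SubNode r T × Option (W × Mt)

open Classical in
/-- The sub-machine built from `M`, with metadata `s` in the output holding region and `0`
elsewhere. A chain node `(b, a, t)` carries the registers of `M` after `t` steps on input `b`
(the registers of the terminal configuration once `M` has halted). -/
noncomputable def subMachine (M : GeneralMachine C W Mt (Option Y)) (init : (Fin r → Bool) → C)
    (T : ℕ) (s : ℤ) : GeneralMachine (SubNode r T) (SubWork W Mt r T) ℤ (Option Y) where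
  work v := (v, match v with
    | .inl _ => none
    | .inr (b, _, t) => some (M.work (M.run (init b) t), M.mdata (M.run (init b) t)))
  mdata v := if SubNode.IsHolding v then s else 0
  out v := match v with
    | .inl _ => none
    | .inr (b, _, t) => M.out (M.run (init b) t)
  registers_injective := fun _ _ h => congrArg (fun p => p.1.1) h
  next v := {v' | SubNode.Edge v v'}

/-- Nodes of the product machine: a node of the first sub-machine in some layer `i`, paired with a
node of the second one in the mirror layer `2T + 2r + 1 - i`. -/
abbrev PairNode (r T : ℕ) : Type :=
  {p : SubNode r T × SubNode r T // SubNode.layer p.1 + SubNode.layer p.2 = 2 * T + 2 * r + 1}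

/-- The sum of the metadata of the two sub-machines, with values `1` and `-1` in their respective
output holding regions. -/
noncomputable def metadataSum (M : GeneralMachine C W Mt (Option Y)) (init : (Fin r → Bool) → C)
    (T : ℕ) (p : PairNode r T) : ℤ :=
  (subMachine M init T 1).mdata p.1.1 + (subMachine M init T (-1)).mdata p.1.2

/-- The product machine: whenever the first sub-machine takes a step forwards, the second one takes
a step backwards. The metadata bit is `0` where the sum of the two metadata values is `1` (the first
sub-machine is in its output holding region), and `1` otherwise. -/
noncomputable def monteCarloMachine (M : GeneralMachine C W Mt (Option Y))
    (init : (Fin r → Bool) → C) (T : ℕ) :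
    GeneralMachine (PairNode r T) (SubWork W Mt r T × SubWork W Mt r T) (Fin 2)
      (Option Y × Option Y) where
  work p := ((subMachine M init T 1).work p.1.1, (subMachine M init T (-1)).work p.1.2)
  mdata p := if metadataSum M init T p = 1 then 0 else 1
  out p := ((subMachine M init T 1).out p.1.1, (subMachine M init T (-1)).out p.1.2)
  registers_injective := fun _ _ h => Subtype.ext
    (Prod.ext (congrArg (fun z => z.1.1.1) h) (congrArg (fun z => z.1.2.1) h))
  next p := {q | q.1.1 ∈ (subMachine M init T 1).next p.1.1 ∧
    p.1.2 ∈ (subMachine M init T (-1)).next q.1.2}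

end Construction

/-! The output holding region is exactly the upper half of the layers and the two sub-machines sit
in mirror layers. So at every node of the product exactly one of them holds an output, and the
metadata bit tells which (`metadataSum_eq`). It remains to see that the string behind that output is
forgotten.

A node is a layer together with `r + 1` bits, the last bit being the copy on the chains
(`equivLayerBits`), and an edge between layers `j` and `j + 1` resamples bit `min j r` (`edge_iff`).
With equal free energies a pair has four neighbours on each available side. Uniformized at rate
`8k`, each coordinate taken alone is then a lazy reflected walk on `N = 2T + 2r + 2` layers that
resamples the crossed bit (`stepMatrix_mulVec_fst`, `stepMatrix_mulVec_snd`). The dependence between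
the coordinates is harmless: a centred observable of the record is a function of the first
coordinate plus a function of the second (`apply_recorded_sub_uniformMean`), both of mean zero over
the first `r` bits in every layer.

Such functions decay because a climb to layer `r` followed by a descent to layer `0` resamples all
`r` input bits, after which the expectation is zero. Explicit supersolutions with values in `[1, 3]`
show that this costs a factor `1 - 1/(3N²)` per step (`norm_iterate_layerStep_le`). Summing over the
Poisson number of jumps gives exponential decay in `k t / N²`, uniformly in the starting node. By
the Markov property, conditioning on earlier records only mixes starting nodes
(`tvDist_nextOutputProb_le`). -/

/-! ### Averaging over bits of a string -/

section BitAverages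

variable {r : ℕ}

/-- The bit that is resampled when the edge between the layers `j` and `j + 1` is crossed. -/
def bitIndex (r j : ℕ) : Fin (r + 1) := ⟨min j r, by omega⟩

/-- Averaging a function of a bit string over the bit with index `min j r`. -/
noncomputable def bitAvg (j : ℕ) :
    ((Fin (r + 1) → Bool) → ℝ) →ₗ[ℝ] ((Fin (r + 1) → Bool) → ℝ) where
  toFun G u := (G (Function.update u (bitIndex r j) false) +
    G (Function.update u (bitIndex r j) true)) / 2
  map_add' G H := by ext u; simp only [Pi.add_apply]; ring
  map_smul' a G := by ext u; simp only [Pi.smul_apply, smul_eq_mul, RingHom.id_apply]; ring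

theorem bitAvg_apply (j : ℕ) (G : (Fin (r + 1) → Bool) → ℝ) (u : Fin (r + 1) → Bool) :
    bitAvg j G u = (G (Function.update u (bitIndex r j) false) +
      G (Function.update u (bitIndex r j) true)) / 2 := rfl

theorem norm_bitAvg_le (j : ℕ) (G : (Fin (r + 1) → Bool) → ℝ) : ‖bitAvg j G‖ ≤ ‖G‖ := by
  refine (pi_norm_le_iff_of_nonneg (norm_nonneg _)).2 fun u => ?_
  have h0 := norm_le_pi_norm G (Function.update u (bitIndex r j) false)
  have h1 := norm_le_pi_norm G (Function.update u (bitIndex r j) true)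
  rw [Real.norm_eq_abs] at *
  rw [bitAvg_apply, abs_le]
  rw [abs_le] at h0 h1
  constructor <;> linarith [h0.1, h0.2, h1.1, h1.2]

theorem bitAvg_comm (i j : ℕ) (G : (Fin (r + 1) → Bool) → ℝ) :
    bitAvg i (bitAvg j G) = bitAvg j (bitAvg i G) := by
  by_cases h : bitIndex r i = bitIndex r j
  · ext u; simp only [bitAvg_apply, h]
  · ext u
    simp only [bitAvg_apply, Function.update_comm h]
    ring

theorem bitAvg_idem (j : ℕ) (G : (Fin (r + 1) → Bool) → ℝ) :
    bitAvg j (bitAvg j G) = bitAvg j G := by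
  ext u; simp only [bitAvg_apply, Function.update_idem]; ring

/-- Flipping the bit permutes the strings, and the average at `u` is the mean of the values at `u`
and at its flip. -/
theorem sum_bitAvg (j : ℕ) (G : (Fin (r + 1) → Bool) → ℝ) :
    ∑ u, bitAvg j G u = ∑ u, G u := by
  let φ : (Fin (r + 1) → Bool) → (Fin (r + 1) → Bool) :=
    fun u => Function.update u (bitIndex r j) (!u (bitIndex r j))
  have hφ : Function.Involutive φ := fun u => by simp [φ]
  have h1 : ∑ u, G (φ u) = ∑ u, G u := Equiv.sum_comp hφ.toPerm G
  have h2 : ∀ u, bitAvg j G u = (G u + G (φ u)) / 2 := fun u => by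
    rw [bitAvg_apply]
    cases hu : u (bitIndex r j)
    · have : Function.update u (bitIndex r j) false = u := by rw [← hu, Function.update_eq_self]
      simp [φ, hu, this]
    · have : Function.update u (bitIndex r j) true = u := by rw [← hu, Function.update_eq_self]
      simp [φ, hu, this, add_comm]
  simp only [h2]
  rw [← Finset.sum_div, Finset.sum_add_distrib, h1]
  ring

theorem bitAvg_eq_self_of_update {j : ℕ} {G : (Fin (r + 1) → Bool) → ℝ}
    (h : ∀ u c, G (Function.update u (bitIndex r j) c) = G u) : bitAvg j G = G := by
  ext u; rw [bitAvg_apply, h, h]; ring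

theorem update_of_bitAvg_eq_self {j : ℕ} {G : (Fin (r + 1) → Bool) → ℝ} (h : bitAvg j G = G)
    (u : Fin (r + 1) → Bool) (c : Bool) : G (Function.update u (bitIndex r j) c) = G u := by
  conv_lhs => rw [← h]
  conv_rhs => rw [← h]
  simp only [bitAvg_apply, Function.update_idem]

theorem eq_of_forall_bitAvg_eq_self {G : (Fin (r + 1) → Bool) → ℝ} (h : ∀ j, bitAvg j G = G)
    (u v : Fin (r + 1) → Bool) : G u = G v := by
  -- The bits of `v` are exchanged for those of `u` one at a time.
  have key : ∀ s : Finset (Fin (r + 1)), G (s.piecewise u v) = G v := by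
    intro s
    induction s using Finset.induction_on with
    | empty => simp
    | insert j s _ ih =>
      have hj : bitIndex r j = j := Fin.ext (by simp [bitIndex]; omega)
      rw [Finset.piecewise_insert, ← hj, update_of_bitAvg_eq_self (h j), ih]
  simpa using key Finset.univ

/-- Averaging over the last `m` of the first `r` bits. -/
noncomputable def tailAvg : ℕ → ((Fin (r + 1) → Bool) → ℝ) →ₗ[ℝ] ((Fin (r + 1) → Bool) → ℝ)
  | 0 => LinearMap.id
  | m + 1 => (bitAvg (r - (m + 1))).comp (tailAvg m)

theorem tailAvg_succ (m : ℕ) (G : (Fin (r + 1) → Bool) → ℝ) :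
    tailAvg (m + 1) G = bitAvg (r - (m + 1)) (tailAvg m G) := rfl

theorem tailAvg_bitAvg (m j : ℕ) (G : (Fin (r + 1) → Bool) → ℝ) :
    tailAvg m (bitAvg j G) = bitAvg j (tailAvg m G) := by
  induction m with
  | zero => rfl
  | succ m ih => rw [tailAvg_succ, ih, bitAvg_comm, tailAvg_succ]

theorem sum_tailAvg (m : ℕ) (G : (Fin (r + 1) → Bool) → ℝ) :
    ∑ u, tailAvg m G u = ∑ u, G u := by
  induction m with
  | zero => rfl
  | succ m ih => rw [tailAvg_succ, sum_bitAvg, ih]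

theorem norm_tailAvg_le (m : ℕ) (G : (Fin (r + 1) → Bool) → ℝ) : ‖tailAvg m G‖ ≤ ‖G‖ := by
  induction m with
  | zero => exact le_rfl
  | succ m ih => exact (norm_bitAvg_le _ _).trans ih

theorem bitAvg_tailAvg_eq_self {m j : ℕ} (hj : j < r) (hm : r ≤ j + m)
    (G : (Fin (r + 1) → Bool) → ℝ) : bitAvg j (tailAvg m G) = tailAvg m G := by
  induction m with
  | zero => omega
  | succ m ih =>
    rw [tailAvg_succ]
    rcases Nat.lt_or_ge (j + m) r with h | h
    · rw [show r - (m + 1) = j by omega, bitAvg_idem]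
    · rw [bitAvg_comm, ih h]

/-- The averaged function is invariant under resampling any bit, hence constant, and its sum is
still zero. Bit `r`, which `tailAvg r` leaves alone, is covered by `hlast`. -/
theorem tailAvg_eq_zero {G : (Fin (r + 1) → Bool) → ℝ} (hlast : bitAvg r G = G)
    (hsum : ∑ u, G u = 0) : tailAvg r G = 0 := by
  have hinv : ∀ j, bitAvg j (tailAvg r G) = tailAvg r G := fun j => by
    rcases Nat.lt_or_ge j r with h | h
    · exact bitAvg_tailAvg_eq_self h (by omega) G
    · have : bitAvg j G = G := by
        conv_rhs => rw [← hlast]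
        ext u
        simp [bitAvg_apply, bitIndex, h]
      rw [← tailAvg_bitAvg, this]
  have hs := sum_tailAvg r G
  ext u
  rw [hsum, Finset.sum_congr rfl fun v _ => eq_of_forall_bitAvg_eq_self hinv v u] at hs
  simpa using hs

/-! ### The walk on the layers that resamples one bit per step -/

/-- One step of the lazy reflected walk on the layers `0, …, L`, resampling the bit that belongs to
the crossed edge, as an operator on functions of layer and string. -/
noncomputable def layerStep (L : ℕ) (F : ℕ → (Fin (r + 1) → Bool) → ℝ) (i : ℕ) :
    (Fin (r + 1) → Bool) → ℝ :=
  (1 / 2 : ℝ) • (if i < L then bitAvg i (F (i + 1)) else F i) +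
    (1 / 2 : ℝ) • (if 0 < i then bitAvg (i - 1) (F (i - 1)) else F i)

/-- Resampling a bit commutes with the full average: if the first `r` bits are uniform at the start,
they remain so whatever edge is crossed. -/
theorem tailAvg_layerStep_eq_zero {L : ℕ} {F : ℕ → (Fin (r + 1) → Bool) → ℝ}
    (hF : ∀ i ≤ L, tailAvg r (F i) = 0) {i : ℕ} (hi : i ≤ L) :
    tailAvg r (layerStep L F i) = 0 := by
  have h1 : tailAvg r (if i < L then bitAvg i (F (i + 1)) else F i) = 0 := by
    split_ifs with h
    · rw [tailAvg_bitAvg, hF _ h, map_zero]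
    · exact hF i hi
  have h2 : tailAvg r (if 0 < i then bitAvg (i - 1) (F (i - 1)) else F i) = 0 := by
    split_ifs with h
    · rw [tailAvg_bitAvg, hF _ (by omega), map_zero]
    · exact hF i hi
  rw [layerStep, map_add, map_smul, map_smul, h1, h2]
  simp

theorem norm_half_add_half_le {E : Type*} [SeminormedAddCommGroup E] [NormedSpace ℝ E] {x y : E}
    {a b : ℝ} (hx : ‖x‖ ≤ a) (hy : ‖y‖ ≤ b) :
    ‖(1 / 2 : ℝ) • x + (1 / 2 : ℝ) • y‖ ≤ (a + b) / 2 := by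
  refine (norm_add_le _ _).trans ?_
  rw [norm_smul, norm_smul, Real.norm_of_nonneg (by norm_num)]
  linarith

/-- Once the walk has been in a layer at least `r` and has come down to layer `i`, the bits
`i, …, r - 1` are fresh. -/
theorem norm_tailAvg_layerStep_le {L : ℕ} {F : ℕ → (Fin (r + 1) → Bool) → ℝ} {ψ : ℕ → ℝ}
    (hF : ∀ i ≤ L, ‖tailAvg (r - i) (F i)‖ ≤ ψ i) {i : ℕ} (hi0 : 0 < i) (hi : i ≤ L) :
    ‖tailAvg (r - i) (layerStep L F i)‖ ≤
      ((if i < L then ψ (i + 1) else ψ i) + ψ (i - 1)) / 2 := by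
  rw [layerStep, map_add, map_smul, map_smul, if_pos hi0]
  refine norm_half_add_half_le ?_ ?_
  · split_ifs with h
    -- After a move up only the shorter segment above `i` is needed; the surplus averages are
    -- contractions and are dropped.
    · refine le_trans ?_ (hF (i + 1) h)
      rw [tailAvg_bitAvg]
      refine (norm_bitAvg_le _ _).trans ?_
      rcases Nat.lt_or_ge i r with hr | hr
      · rw [show r - i = (r - (i + 1)) + 1 by omega, tailAvg_succ]
        exact norm_bitAvg_le _ _
      · rw [show r - i = 0 by omega, show r - (i + 1) = 0 by omega]
    · exact hF i hi
  -- A move down resamples bit `i - 1`, which for `i ≤ r` is just the average that extends `tailAvg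
  -- (r - i)` to `tailAvg (r - (i - 1))`.
  · refine le_trans ?_ (hF (i - 1) (by omega))
    rw [tailAvg_bitAvg]
    rcases Nat.lt_or_ge r i with hr | hr
    · rw [show r - i = 0 by omega, show r - (i - 1) = 0 by omega]
      exact norm_bitAvg_le _ _
    · rw [show r - (i - 1) = (r - i) + 1 by omega, tailAvg_succ,
        show r - (r - i + 1) = i - 1 by omega]

/-- For the climb, where no average is exploited yet. At `i = 0` the truncated `i - 1 = 0` is the
reflection at the bottom. -/
theorem norm_layerStep_le {L : ℕ} {F : ℕ → (Fin (r + 1) → Bool) → ℝ} {φ : ℕ → ℝ} {i : ℕ}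
    (hi : i < L) (h0 : ‖F (i + 1)‖ ≤ φ (i + 1)) (h1 : ‖F (i - 1)‖ ≤ φ (i - 1)) :
    ‖layerStep L F i‖ ≤ (φ (i + 1) + φ (i - 1)) / 2 := by
  rw [layerStep, if_pos hi]
  refine norm_half_add_half_le ((norm_bitAvg_le _ _).trans h0) ?_
  split_ifs with h
  · exact (norm_bitAvg_le _ _).trans h1
  · rwa [show i - 1 = i by omega] at h1 ⊢

/-! ### Supersolutions and the spectral decay rate -/

/-- Supersolution for the descent from the layers at least `r` to layer `0`. -/
noncomputable def descentBound (N : ℝ) (i : ℕ) : ℝ := 1 + i * (2 * N - i) / N ^ 2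

/-- Supersolution for the ascent from a layer below `r` to layer `r`. -/
noncomputable def ascentBound (N : ℝ) (i : ℕ) : ℝ := 3 - i * (i + 1) / N ^ 2

/-- The factor by which the supersolutions shrink in one step. -/
noncomputable def decayFactor (N : ℝ) : ℝ := 1 - 1 / (3 * N ^ 2)

theorem decayFactor_nonneg {N : ℝ} (hN : 1 ≤ N) : 0 ≤ decayFactor N := by
  rw [decayFactor, sub_nonneg, div_le_one (by positivity)]
  nlinarith

theorem one_le_descentBound {N : ℝ} {i : ℕ} (hi : (i : ℝ) ≤ N) : 1 ≤ descentBound N i := by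
  have h0 : (0 : ℝ) ≤ i := Nat.cast_nonneg i
  have : 0 ≤ (i : ℝ) * (2 * N - i) / N ^ 2 :=
    div_nonneg (mul_nonneg h0 (by linarith)) (sq_nonneg _)
  rw [descentBound]
  linarith

theorem descentBound_le_two {N : ℝ} (hN : 1 ≤ N) (i : ℕ) : descentBound N i ≤ 2 := by
  have : (i : ℝ) * (2 * N - i) / N ^ 2 ≤ 1 := by
    rw [div_le_one (by positivity)]
    nlinarith [sq_nonneg (N - i)]
  rw [descentBound]
  linarith

theorem two_le_ascentBound {N : ℝ} (hN : 1 ≤ N) {i : ℕ} (hi : (i : ℝ) + 1 ≤ N) :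
    2 ≤ ascentBound N i := by
  have h0 : (0 : ℝ) ≤ i := Nat.cast_nonneg i
  have : (i : ℝ) * (i + 1) / N ^ 2 ≤ 1 := by
    rw [div_le_one (by positivity)]
    nlinarith
  rw [ascentBound]
  linarith

theorem ascentBound_le_three {N : ℝ} (i : ℕ) : ascentBound N i ≤ 3 := by
  have : 0 ≤ (i : ℝ) * (i + 1) / N ^ 2 := by positivity
  rw [ascentBound]
  linarith

/-- Turns an additive drift `1/N²` into a multiplicative one; the upper bound `3` on both
supersolutions is the `3` in `decayFactor`. -/
theorem sub_inv_le_decayFactor_mul {N x : ℝ} (hN : 1 ≤ N) (hx : x ≤ 3) :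
    x - 1 / N ^ 2 ≤ decayFactor N * x := by
  have h : x * (1 / (3 * N ^ 2)) ≤ 3 * (1 / (3 * N ^ 2)) :=
    mul_le_mul_of_nonneg_right hx (by positivity)
  have h' : 3 * (1 / (3 * N ^ 2)) = 1 / N ^ 2 := by field_simp
  rw [decayFactor]
  linarith

/-- The parabola has second difference `-2/N²`, so averaging over the neighbours lowers it by
`1/N²`. -/
theorem descentBound_step {N : ℝ} (hN : 1 ≤ N) {i : ℕ} (hi0 : 0 < i) :
    (descentBound N (i + 1) + descentBound N (i - 1)) / 2 ≤ decayFactor N * descentBound N i := by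
  refine le_trans (le_of_eq ?_)
    (sub_inv_le_decayFactor_mul hN ((descentBound_le_two hN i).trans (by norm_num)))
  simp only [descentBound]
  push_cast [Nat.cast_sub (show 1 ≤ i from hi0)]
  field_simp
  ring

/-- The parabola peaks at `N = L + 1`, so replacing a step beyond the top layer by staying put only
helps. -/
theorem descentBound_le_succ {N : ℝ} {i : ℕ} (hi : (i : ℝ) + 1 ≤ N) :
    descentBound N i ≤ descentBound N (i + 1) := by
  have : (i : ℝ) * (2 * N - i) / N ^ 2 ≤ (i + 1 : ℝ) * (2 * N - (i + 1)) / N ^ 2 := by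
    gcongr ?_ / _
    nlinarith
  simp only [descentBound]
  push_cast
  linarith

/-- The polynomial `i(i + 1)` takes equal values at `0` and `-1`, so the reflection at layer `0`
produces the same drift `1/N²` as the interior. -/
theorem ascentBound_step {N : ℝ} (hN : 1 ≤ N) (i : ℕ) :
    (ascentBound N (i + 1) + ascentBound N (i - 1)) / 2 ≤ decayFactor N * ascentBound N i := by
  refine le_trans (le_of_eq ?_) (sub_inv_le_decayFactor_mul hN (ascentBound_le_three i))
  rcases Nat.eq_zero_or_pos i with rfl | hi0
  · simp only [ascentBound]
    norm_num
    field_simp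
    ring
  · simp only [ascentBound]
    push_cast [Nat.cast_sub (show 1 ≤ i from hi0)]
    field_simp
    ring

/-- A maximum principle for the descent: layer `0` is absorbing with value zero (`hzero`), the top
layer reflects, and `descentBound` dominates in between. -/
theorem norm_tailAvg_iterate_layerStep_le {L : ℕ} {F : ℕ → (Fin (r + 1) → Bool) → ℝ} {K : ℝ}
    (hK : 0 ≤ K) (hF : ∀ i ≤ L, ‖F i‖ ≤ K) (hF0 : ∀ i ≤ L, tailAvg r (F i) = 0) (n : ℕ) :
    ∀ i ≤ L, ‖tailAvg (r - i) ((layerStep L)^[n] F i)‖ ≤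
      K * decayFactor (L + 1) ^ n * descentBound (L + 1) i := by
  have hN : (1 : ℝ) ≤ (L : ℝ) + 1 := by linarith [(Nat.cast_nonneg L : (0 : ℝ) ≤ L)]
  have hρ := decayFactor_nonneg hN
  have hzero : ∀ n, ∀ i ≤ L, tailAvg r ((layerStep L)^[n] F i) = 0 := by
    intro n
    induction n with
    | zero => exact hF0
    | succ n ih =>
      intro i hi
      rw [Function.iterate_succ_apply']
      exact tailAvg_layerStep_eq_zero ih hi
  have hcast : ∀ i ≤ L, (i : ℝ) + 1 ≤ (L : ℝ) + 1 := fun i hi => by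
    have : (i : ℝ) ≤ L := by exact_mod_cast hi
    linarith
  induction n with
  | zero =>
    intro i hi
    have h1 := one_le_descentBound (N := (L : ℝ) + 1) (i := i) (by linarith [hcast i hi])
    rw [pow_zero, mul_one]
    exact ((norm_tailAvg_le _ _).trans (hF i hi)).trans (le_mul_of_one_le_right hK h1)
  | succ n ih =>
    intro i hi
    have hpos : 0 ≤ K * decayFactor ((L : ℝ) + 1) ^ n := by positivity
    rcases Nat.eq_zero_or_pos i with rfl | hi0
    · rw [Nat.sub_zero, hzero (n + 1) 0 hi, norm_zero]
      have h1 := one_le_descentBound (N := (L : ℝ) + 1) (i := 0) (by linarith [hcast 0 hi])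
      positivity
    · rw [Function.iterate_succ_apply']
      refine (norm_tailAvg_layerStep_le
        (ψ := fun i => K * decayFactor ((L : ℝ) + 1) ^ n * descentBound (L + 1) i)
        ih hi0 hi).trans ?_
      have hstep := mul_le_mul_of_nonneg_left (descentBound_step hN hi0) hpos
      have hlast := mul_le_mul_of_nonneg_left (descentBound_le_succ (hcast i hi)) hpos
      rw [pow_succ]
      split_ifs with h <;> linarith

/-- Functions of layer and string that have mean zero over the first `r` bits decay at the rate of
the inverse square of the number of layers. -/
theorem norm_iterate_layerStep_le {L : ℕ} (hr : r ≤ L) {F : ℕ → (Fin (r + 1) → Bool) → ℝ} {K : ℝ}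
    (hK : 0 ≤ K) (hF : ∀ i ≤ L, ‖F i‖ ≤ K) (hF0 : ∀ i ≤ L, tailAvg r (F i) = 0) (n : ℕ)
    {i : ℕ} (hi : i ≤ L) :
    ‖(layerStep L)^[n] F i‖ ≤ 3 * K * decayFactor (L + 1) ^ n := by
  have hN : (1 : ℝ) ≤ (L : ℝ) + 1 := by linarith [(Nat.cast_nonneg L : (0 : ℝ) ≤ L)]
  have hρ := decayFactor_nonneg hN
  have hpos : ∀ n, 0 ≤ K * decayFactor ((L : ℝ) + 1) ^ n := fun n => by positivity
  have hcast : ∀ i ≤ L, (i : ℝ) + 1 ≤ (L : ℝ) + 1 := fun i hi => by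
    have : (i : ℝ) ≤ L := by exact_mod_cast hi
    linarith
  -- From layer `r` on there is nothing to average, so the descent bound controls the function
  -- itself.
  have hhigh : ∀ n, ∀ i ≤ L, r ≤ i →
      ‖(layerStep L)^[n] F i‖ ≤ K * decayFactor ((L : ℝ) + 1) ^ n * 2 := fun n i hi hri => by
    have h := norm_tailAvg_iterate_layerStep_le hK hF hF0 n i hi
    rw [show r - i = 0 by omega] at h
    exact h.trans (mul_le_mul_of_nonneg_left (descentBound_le_two hN i) (hpos n))
  -- The climb has its boundary at layer `r`, where `hhigh` gives the constant `2`, which lies below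
  -- `ascentBound`.
  have hlow : ∀ n, ∀ i ≤ r, ‖(layerStep L)^[n] F i‖ ≤
      K * decayFactor ((L : ℝ) + 1) ^ n * ascentBound (L + 1) i := by
    intro n
    induction n with
    | zero =>
      intro i hi
      have h1 := two_le_ascentBound hN (hcast i (hi.trans hr))
      rw [pow_zero, mul_one]
      exact (hF i (hi.trans hr)).trans (le_mul_of_one_le_right hK (by linarith))
    | succ n ih =>
      intro i hi
      rcases hi.eq_or_lt with rfl | hlt
      · exact (hhigh (n + 1) i hr le_rfl).trans
          (mul_le_mul_of_nonneg_left (two_le_ascentBound hN (hcast i hr)) (hpos _))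
      · rw [Function.iterate_succ_apply']
        refine (norm_layerStep_le
          (φ := fun i => K * decayFactor ((L : ℝ) + 1) ^ n * ascentBound (L + 1) i)
          (by omega) (ih (i + 1) hlt) (ih (i - 1) (by omega))).trans ?_
        have hstep := mul_le_mul_of_nonneg_left (ascentBound_step hN i) (hpos n)
        rw [pow_succ]
        linarith
  rcases Nat.le_total i r with h | h
  · refine (hlow n i h).trans ?_
    have := mul_le_mul_of_nonneg_left (ascentBound_le_three (N := (L : ℝ) + 1) i) (hpos n)
    linarith
  · refine (hhigh n i hi h).trans ?_
    have := hpos n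
    linarith

end BitAverages

/-! ### Sums over neighbours in the layered graphs -/

namespace SubNode

variable {r T : ℕ}

/-- The bit string of a node; for a chain node it consists of the input and the copy. -/
def bits : SubNode r T → (Fin (r + 1) → Bool)
  | .inl (_, u) => u
  | .inr (b, a, _) => Fin.snoc b a

theorem layer_le (x : SubNode r T) : layer x ≤ 2 * T + 2 * r + 1 := by
  rcases x with ⟨i, u⟩ | ⟨b, a, t⟩
  · have := i.2
    simp only [layer]
    omega
  · have := t.2
    simp only [layer]
    omega

/-- From layer `r` on the resampled bit is the last one, which selects the copy of the chain. -/
theorem forall_ne_bitIndex_iff {j : ℕ} (hj : r ≤ j) {p : Fin (r + 1) → Prop} :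
    (∀ k, k ≠ bitIndex r j → p k) ↔ ∀ k : Fin r, p k.castSucc := by
  have hlast : bitIndex r j = Fin.last r := Fin.ext (by simp [bitIndex, hj])
  rw [hlast]
  refine ⟨fun h k => h _ (Fin.castSucc_lt_last k).ne, fun h k hk => ?_⟩
  obtain ⟨k, rfl⟩ := Fin.exists_castSucc_eq.2 hk
  exact h k

/-- A single rule covers the randomizer, the junction and the chains. The two copies serve to give
chain nodes two neighbours per side, as in the randomizer. -/
theorem edge_iff (x y : SubNode r T) : Edge x y ↔
    layer y = layer x + 1 ∧ ∀ k, k ≠ bitIndex r (layer x) → bits x k = bits y k := by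
  rcases x with ⟨i, u⟩ | ⟨b, a, t⟩ <;> rcases y with ⟨j, v⟩ | ⟨b', a', t'⟩
  · have hi : bitIndex r i = i := Fin.ext (by simp [bitIndex]; omega)
    simp only [Edge, layer, bits, hi]
  · simp only [Edge, layer, bits]
    have := i.2
    constructor
    · rintro ⟨h1, h2, h3⟩
      refine ⟨by omega, ?_⟩
      rw [forall_ne_bitIndex_iff (by omega)]
      simpa using h3
    · rintro ⟨h1, h2⟩
      rw [forall_ne_bitIndex_iff (by omega)] at h2
      exact ⟨by omega, by omega, by simpa using h2⟩
  · simp only [Edge, layer, false_iff, not_and]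
    have := j.2
    omega
  · simp only [Edge, layer, bits]
    rw [forall_ne_bitIndex_iff (by omega)]
    simp only [Fin.snoc_castSucc, funext_iff]
    constructor
    · rintro ⟨h1, h2⟩
      exact ⟨by omega, h1⟩
    · rintro ⟨h1, h2⟩
      exact ⟨h2, by omega⟩

/-- A node is determined by its layer and its bit string. -/
noncomputable def equivLayerBits :
    SubNode r T ≃ Fin (2 * T + 2 * r + 2) × (Fin (r + 1) → Bool) :=
  Equiv.ofBijective (fun x => (⟨layer x, Nat.lt_succ_of_le (layer_le x)⟩, bits x)) (by
    constructor
    · intro x y h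
      have h1 : layer x = layer y := congrArg (fun z => (z.1 : ℕ)) h
      have h2 : bits x = bits y := congrArg Prod.snd h
      rcases x with ⟨i, u⟩ | ⟨b, a, t⟩ <;> rcases y with ⟨j, v⟩ | ⟨b', a', t'⟩ <;>
        simp only [layer, bits] at h1 h2
      · rw [Fin.ext h1, h2]
      · have := i.2
        omega
      · have := j.2
        omega
      · obtain ⟨h3, h4⟩ := Fin.snoc_injective2 h2
        rw [h3, h4, show t = t' from Fin.ext (by omega)]
    · rintro ⟨l, u⟩
      have := l.2
      rcases Nat.lt_or_ge r l with h | h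
      · refine ⟨.inr (Fin.init u, u (Fin.last r), ⟨l - (r + 1), by omega⟩),
          Prod.ext (Fin.ext ?_) ?_⟩
        · simp only [layer]
          omega
        · simp only [bits]
          exact Fin.snoc_init_self u
      · exact ⟨.inl (⟨l, by omega⟩, u), rfl⟩)

theorem sum_ite_agree (j : Fin (r + 1)) (G : (Fin (r + 1) → Bool) → ℝ) (u : Fin (r + 1) → Bool) :
    (∑ v, if ∀ k, k ≠ j → u k = v k then G v else 0) =
      G (Function.update u j false) + G (Function.update u j true) := by
  have hne : Function.update u j false ≠ Function.update u j true := fun h => by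
    simpa using congrFun h j
  rw [← Finset.sum_filter, ← Finset.sum_pair hne]
  refine Finset.sum_congr (Finset.ext fun v => ?_) fun _ _ => rfl
  simp only [Finset.mem_filter, Finset.mem_univ, true_and, Finset.mem_insert,
    Finset.mem_singleton, Function.eq_update_iff]
  constructor
  · intro h
    cases hv : v j
    · exact .inl ⟨rfl, fun k hk => (h k hk).symm⟩
    · exact .inr ⟨rfl, fun k hk => (h k hk).symm⟩
  · rintro (h | h) <;> exact fun k hk => (h.2 k hk).symm

/-- The function on the nodes given by a function of layer and string. -/
def ofLayerBits (F : ℕ → (Fin (r + 1) → Bool) → ℝ) (x : SubNode r T) : ℝ := F (layer x) (bits x)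

theorem sum_ite_layer_agree (F : ℕ → (Fin (r + 1) → Bool) → ℝ) (l j : ℕ)
    (u : Fin (r + 1) → Bool) :
    (∑ y : SubNode r T, if layer y = l ∧ ∀ k, k ≠ bitIndex r j → u k = bits y k
      then ofLayerBits F y else 0) =
      if l ≤ 2 * T + 2 * r + 1 then 2 * bitAvg j (F l) u else 0 := by
  have h1 := equivLayerBits.sum_comp
    (fun z : Fin (2 * T + 2 * r + 2) × (Fin (r + 1) → Bool) =>
      if (z.1 : ℕ) = l ∧ ∀ k, k ≠ bitIndex r j → u k = z.2 k then F z.1 z.2 else 0)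
  refine h1.trans ?_
  rw [Fintype.sum_prod_type]
  split_ifs with h
  · rw [Finset.sum_eq_single (⟨l, Nat.lt_succ_of_le h⟩ : Fin (2 * T + 2 * r + 2))]
    · simp only [true_and]
      rw [sum_ite_agree, bitAvg_apply]
      ring
    · intro i _ hi
      refine Finset.sum_eq_zero fun v _ => if_neg fun h' => hi (Fin.ext h'.1)
    · exact fun h' => absurd (Finset.mem_univ _) h'
  · refine Finset.sum_eq_zero fun i _ => Finset.sum_eq_zero fun v _ => if_neg fun h' => ?_
    have := i.2
    have := h'.1
    omega

open Classical in
theorem sum_edge_right (F : ℕ → (Fin (r + 1) → Bool) → ℝ) (x : SubNode r T) :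
    (∑ y, if Edge x y then ofLayerBits F y else 0) =
      if layer x < 2 * T + 2 * r + 1 then 2 * bitAvg (layer x) (F (layer x + 1)) (bits x)
      else 0 := by
  have h := sum_ite_layer_agree (T := T) F (layer x + 1) (layer x) (bits x)
  simp only [edge_iff]
  exact (Finset.sum_congr rfl fun y _ => by congr).trans h

open Classical in
theorem sum_edge_left (F : ℕ → (Fin (r + 1) → Bool) → ℝ) (x : SubNode r T) :
    (∑ y, if Edge y x then ofLayerBits F y else 0) =
      if 0 < layer x then 2 * bitAvg (layer x - 1) (F (layer x - 1)) (bits x) else 0 := by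
  have hx := layer_le x
  split_ifs with h0
  · have h := sum_ite_layer_agree (T := T) F (layer x - 1) (layer x - 1) (bits x)
    rw [if_pos (by omega)] at h
    rw [← h]
    refine Finset.sum_congr rfl fun y _ => ?_
    refine if_congr ?_ rfl rfl
    rw [edge_iff]
    constructor
    · rintro ⟨h1, h2⟩
      have h3 : layer y = layer x - 1 := by omega
      exact ⟨h3, fun k hk => (h2 k (h3 ▸ hk)).symm⟩
    · rintro ⟨h1, h2⟩
      exact ⟨by omega, fun k hk => (h2 k (h1 ▸ hk)).symm⟩
  · refine Finset.sum_eq_zero fun y _ => if_neg fun h => ?_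
    have := ((edge_iff y x).1 h).1
    omega

theorem bitAvg_const (j : ℕ) : bitAvg (r := r) j (fun _ => 1) = fun _ => 1 := by
  ext u
  simp [bitAvg_apply]

open Classical in
theorem card_edge_right (x : SubNode r T) :
    (∑ y, if Edge x y then (1 : ℝ) else 0) = if layer x < 2 * T + 2 * r + 1 then 2 else 0 := by
  refine (sum_edge_right (fun _ _ => 1) x).trans ?_
  simp [bitAvg_const]

open Classical in
theorem card_edge_left (x : SubNode r T) :
    (∑ y, if Edge y x then (1 : ℝ) else 0) = if 0 < layer x then 2 else 0 := by
  refine (sum_edge_left (fun _ _ => 1) x).trans ?_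
  simp [bitAvg_const]

end SubNode

namespace PairNode

open SubNode

variable {r T : ℕ}

/-- `p` is joined to `q` by a step of the product machine. -/
def Step (p q : PairNode r T) : Prop := Edge p.1.1 q.1.1 ∧ Edge q.1.2 p.1.2

theorem Step.layer_eq {p q : PairNode r T} (h : Step p q) : layer q.1.1 = layer p.1.1 + 1 :=
  ((edge_iff _ _).1 h.1).1

/-- Opposite moves preserve the mirror condition, so it may be dropped from sums over steps; these
then factor over the two coordinates. -/
theorem sum_eq_sum_prod (H : SubNode r T × SubNode r T → ℝ)
    (hH : ∀ z, layer z.1 + layer z.2 ≠ 2 * T + 2 * r + 1 → H z = 0) :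
    ∑ q : PairNode r T, H q.1 = ∑ x, ∑ y, H (x, y) := by
  rw [← Fintype.sum_prod_type']
  have h : ∑ z with layer z.1 + layer z.2 = 2 * T + 2 * r + 1, H z =
      ∑ q : PairNode r T, H q.1 := Finset.sum_subtype _ (by simp) H
  rw [← h]
  exact Finset.sum_filter_of_ne fun z _ hz => by_contra fun hne => hz (hH z hne)

open Classical in
theorem sum_step_right (f g : SubNode r T → ℝ) (p : PairNode r T) :
    (∑ q, if Step p q then f q.1.1 * g q.1.2 else 0) =
      (∑ x, if Edge p.1.1 x then f x else 0) * ∑ y, if Edge y p.1.2 then g y else 0 := by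
  rw [Finset.sum_mul_sum]
  have h := sum_eq_sum_prod
    (fun z => if Edge p.1.1 z.1 ∧ Edge z.2 p.1.2 then f z.1 * g z.2 else 0) fun z hz => if_neg fun h => by
      have h1 := ((edge_iff _ _).1 h.1).1
      have h2 := ((edge_iff _ _).1 h.2).1
      have h3 := p.2
      exact hz (by omega)
  refine Eq.trans ?_ (h.trans ?_)
  · exact Finset.sum_congr rfl fun q _ => if_congr Iff.rfl rfl rfl
  · refine Finset.sum_congr rfl fun x _ => Finset.sum_congr rfl fun y _ => ?_
    by_cases h1 : Edge p.1.1 x <;> by_cases h2 : Edge y p.1.2 <;> simp [h1, h2]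

open Classical in
theorem sum_step_left (f g : SubNode r T → ℝ) (p : PairNode r T) :
    (∑ q, if Step q p then f q.1.1 * g q.1.2 else 0) =
      (∑ x, if Edge x p.1.1 then f x else 0) * ∑ y, if Edge p.1.2 y then g y else 0 := by
  rw [Finset.sum_mul_sum]
  have h := sum_eq_sum_prod
    (fun z => if Edge z.1 p.1.1 ∧ Edge p.1.2 z.2 then f z.1 * g z.2 else 0) fun z hz => if_neg fun h => by
      have h1 := ((edge_iff _ _).1 h.1).1
      have h2 := ((edge_iff _ _).1 h.2).1
      have h3 := p.2
      exact hz (by omega)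
  refine Eq.trans ?_ (h.trans ?_)
  · exact Finset.sum_congr rfl fun q _ => if_congr Iff.rfl rfl rfl
  · refine Finset.sum_congr rfl fun x _ => Finset.sum_congr rfl fun y _ => ?_
    by_cases h1 : Edge x p.1.1 <;> by_cases h2 : Edge p.1.2 y <;> simp [h1, h2]

end PairNode

/-! ### The jump chain of an adiabatic embedding of the product machine -/

section JumpChain

open SubNode PairNode

variable {C W Mt Y : Type*} {r T : ℕ} {M : GeneralMachine C W Mt (Option Y)}
  {init : (Fin r → Bool) → C}

namespace PhysicalEmbedding

/-- The transition matrix of the uniformized process: jumps happen at rate `8 * rate`. -/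
noncomputable def stepMatrix {C W Mt O : Type*} {M : GeneralMachine C W Mt O} [Fintype C]
    [DecidableEq C] (P : PhysicalEmbedding M) : Matrix C C ℝ :=
  1 + (8 * P.rate)⁻¹ • P.generator

theorem jumpRate_nonneg {C W Mt O : Type*} {M : GeneralMachine C W Mt O}
    (P : PhysicalEmbedding M) (u v : C) : 0 ≤ P.jumpRate u v := by
  have := P.rate_pos
  rw [jumpRate]
  split_ifs
  · rw [metropolis]
    split_ifs <;> positivity
  · exact le_rfl

theorem jumpRate_self {C W Mt O : Type*} {M : GeneralMachine C W Mt O}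
    (P : PhysicalEmbedding M) (u : C) : P.jumpRate u u = 0 := by
  simp [jumpRate]

theorem generator_mulVec {C W Mt O : Type*} {M : GeneralMachine C W Mt O} [Fintype C]
    [DecidableEq C] (P : PhysicalEmbedding M) (φ : C → ℝ) (u : C) :
    P.generator.mulVec φ u = ∑ v, P.jumpRate u v * φ v - (∑ v, P.jumpRate u v) * φ u := by
  have h : ∀ v, P.generator u v * φ v =
      P.jumpRate u v * φ v - if u = v then (∑ z, P.jumpRate u z) * φ u else 0 := fun v => by
    simp only [generator, Matrix.of_apply]
    split_ifs with h
    · subst h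
      rw [jumpRate_self]
      ring
    · ring
  rw [Matrix.mulVec, dotProduct, Finset.sum_congr rfl fun v _ => h v, Finset.sum_sub_distrib]
  simp

theorem stepMatrix_mulVec {C W Mt O : Type*} {M : GeneralMachine C W Mt O} [Fintype C]
    [DecidableEq C] (P : PhysicalEmbedding M) (φ : C → ℝ) (u : C) :
    P.stepMatrix.mulVec φ u = φ u + (8 * P.rate)⁻¹ *
      (∑ v, P.jumpRate u v * φ v - (∑ v, P.jumpRate u v) * φ u) := by
  rw [stepMatrix, Matrix.add_mulVec, Matrix.one_mulVec, Matrix.smul_mulVec, Pi.add_apply,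
    Pi.smul_apply, generator_mulVec, smul_eq_mul]

/-- Uniformization: the generator is `8k` times the step matrix minus the identity, and the scalar
part splits off the exponential. -/
theorem transition_eq {C W Mt O : Type*} {M : GeneralMachine C W Mt O} [Fintype C]
    [DecidableEq C] (P : PhysicalEmbedding M) (t : ℝ) :
    P.transition t = Real.exp (-(8 * P.rate * t)) •
      NormedSpace.exp ((8 * P.rate * t) • P.stepMatrix) := by
  let _ : NormedRing (Matrix C C ℝ) := Matrix.linftyOpNormedRing
  let _ : NormedAlgebra ℝ (Matrix C C ℝ) := Matrix.linftyOpNormedAlgebra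
  have hk := P.rate_pos
  have h : t • P.generator = (8 * P.rate * t) • P.stepMatrix +
      (-(8 * P.rate * t)) • (1 : Matrix C C ℝ) := by
    rw [stepMatrix, smul_add, smul_smul]
    have : 8 * P.rate * t * (8 * P.rate)⁻¹ = t := by field_simp
    rw [this, neg_smul]
    abel
  have hc : Commute ((8 * P.rate * t) • P.stepMatrix) ((-(8 * P.rate * t)) • (1 : Matrix C C ℝ)) :=
    ((Commute.one_right _).smul_right _)
  rw [transition, h, Matrix.exp_add_of_commute _ _ hc]
  have h1 : NormedSpace.exp ((-(8 * P.rate * t)) • (1 : Matrix C C ℝ)) =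
      Real.exp (-(8 * P.rate * t)) • (1 : Matrix C C ℝ) := by
    rw [← Algebra.algebraMap_eq_smul_one, ← Algebra.algebraMap_eq_smul_one, Real.exp_eq_exp_ℝ,
      NormedSpace.algebraMap_exp_comm]
    rfl
  rw [h1, mul_smul_comm, mul_one]

open Classical in
theorem jumpRate_eq_of_isAdiabatic {P : PhysicalEmbedding (monteCarloMachine M init T)}
    (hP : P.IsAdiabatic) (p q : PairNode r T) :
    P.jumpRate p q = P.rate * ((if Step p q then 1 else 0) + if Step q p then 1 else 0) := by
  have hm : P.metropolis p q = P.rate := by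
    rw [metropolis, if_neg]
    rw [hP p q]
    exact lt_irrefl _
  have hpq : q ∈ (monteCarloMachine M init T).next p ↔ Step p q := Iff.rfl
  have hqp : p ∈ (monteCarloMachine M init T).next q ↔ Step q p := Iff.rfl
  rw [jumpRate, hm, hpq, hqp]
  by_cases h1 : Step p q
  · have hl := h1.layer_eq
    have hne : p ≠ q := fun h => by subst h; omega
    have h2 : ¬ Step q p := fun h => by
      have := h.layer_eq
      omega
    simp [h1, h2, hne]
  · by_cases h2 : Step q p
    · have hl := h2.layer_eq
      have hne : p ≠ q := fun h => by subst h; omega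
      simp [h1, h2, hne]
    · simp [h1, h2]

open Classical in
theorem sum_jumpRate_mul {P : PhysicalEmbedding (monteCarloMachine M init T)}
    (hP : P.IsAdiabatic) (f g : SubNode r T → ℝ) (p : PairNode r T) :
    ∑ q, P.jumpRate p q * (f q.1.1 * g q.1.2) = P.rate *
      ((∑ x, if Edge p.1.1 x then f x else 0) * (∑ y, if Edge y p.1.2 then g y else 0) +
        (∑ x, if Edge x p.1.1 then f x else 0) * ∑ y, if Edge p.1.2 y then g y else 0) := by
  rw [← sum_step_right, ← sum_step_left, ← Finset.sum_add_distrib, Finset.mul_sum]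
  refine Finset.sum_congr rfl fun q _ => ?_
  rw [jumpRate_eq_of_isAdiabatic hP]
  by_cases h1 : Step p q <;> by_cases h2 : Step q p <;> (simp [h1, h2]; try ring)

theorem sum_jumpRate {P : PhysicalEmbedding (monteCarloMachine M init T)}
    (hP : P.IsAdiabatic) (p : PairNode r T) :
    ∑ q, P.jumpRate p q = P.rate * ((if layer p.1.1 < 2 * T + 2 * r + 1 then 4 else 0) +
      if 0 < layer p.1.1 then 4 else 0) := by
  have h := sum_jumpRate_mul hP (fun _ => 1) (fun _ => 1) p
  simp only [mul_one] at h
  rw [h, card_edge_right, card_edge_left, card_edge_right, card_edge_left]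
  have := p.2
  by_cases h1 : layer p.1.1 < 2 * T + 2 * r + 1 <;> by_cases h2 : 0 < layer p.1.1
  · have h3 : 0 < layer p.1.2 := by omega
    have h4 : layer p.1.2 < 2 * T + 2 * r + 1 := by omega
    simp only [h1, h2, h3, h4, if_true]
    norm_num
  · have h3 : 0 < layer p.1.2 := by omega
    simp only [h1, h2, h3, if_true, if_false]
    norm_num
  · have h4 : layer p.1.2 < 2 * T + 2 * r + 1 := by omega
    simp only [h1, h2, h4, if_true, if_false]
    norm_num
  · omega

/-- The second coordinate contributes only its number of neighbours, a factor `2`. In an end layer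
the exit rate is `4k` out of `8k`, so half of the mass stays, as in `layerStep`. -/
theorem stepMatrix_mulVec_fst {P : PhysicalEmbedding (monteCarloMachine M init T)}
    (hP : P.IsAdiabatic) (F : ℕ → (Fin (r + 1) → Bool) → ℝ) :
    P.stepMatrix.mulVec (fun p => ofLayerBits F p.1.1) =
      fun p => ofLayerBits (layerStep (2 * T + 2 * r + 1) F) p.1.1 := by
  ext p
  have hk := P.rate_pos
  have h := sum_jumpRate_mul hP (ofLayerBits F) (fun _ => 1) p
  simp only [mul_one] at h
  rw [stepMatrix_mulVec, h, sum_jumpRate hP, sum_edge_right, sum_edge_left, card_edge_left,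
    card_edge_right]
  simp only [ofLayerBits, layerStep, Pi.add_apply, Pi.smul_apply, smul_eq_mul]
  have := p.2
  by_cases h1 : layer p.1.1 < 2 * T + 2 * r + 1 <;> by_cases h2 : 0 < layer p.1.1
  · have h3 : 0 < layer p.1.2 := by omega
    have h4 : layer p.1.2 < 2 * T + 2 * r + 1 := by omega
    simp only [h1, h2, h3, h4, if_true]
    field_simp
    ring
  · have h3 : 0 < layer p.1.2 := by omega
    simp only [h1, h2, h3, if_true, if_false]
    field_simp
    ring
  · have h4 : layer p.1.2 < 2 * T + 2 * r + 1 := by omega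
    simp only [h1, h2, h4, if_true, if_false]
    field_simp
    ring
  · omega

theorem stepMatrix_mulVec_snd {P : PhysicalEmbedding (monteCarloMachine M init T)}
    (hP : P.IsAdiabatic) (F : ℕ → (Fin (r + 1) → Bool) → ℝ) :
    P.stepMatrix.mulVec (fun p => ofLayerBits F p.1.2) =
      fun p => ofLayerBits (layerStep (2 * T + 2 * r + 1) F) p.1.2 := by
  ext p
  have hk := P.rate_pos
  have h := sum_jumpRate_mul hP (fun _ => 1) (ofLayerBits F) p
  simp only [one_mul] at h
  rw [stepMatrix_mulVec, h, sum_jumpRate hP, sum_edge_right, sum_edge_left, card_edge_left,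
    card_edge_right]
  simp only [ofLayerBits, layerStep, Pi.add_apply, Pi.smul_apply, smul_eq_mul]
  have := p.2
  by_cases h1 : layer p.1.1 < 2 * T + 2 * r + 1 <;> by_cases h2 : 0 < layer p.1.1
  · have h3 : 0 < layer p.1.2 := by omega
    have h4 : layer p.1.2 < 2 * T + 2 * r + 1 := by omega
    simp only [h1, h2, h3, h4, if_true]
    field_simp
    ring
  · have h3 : 0 < layer p.1.2 := by omega
    have h4 : ¬ layer p.1.2 < 2 * T + 2 * r + 1 := by omega
    simp only [h1, h2, h3, h4, if_true, if_false]
    field_simp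
    ring
  · have h4 : layer p.1.2 < 2 * T + 2 * r + 1 := by omega
    have h3 : ¬ 0 < layer p.1.2 := by omega
    simp only [h1, h2, h3, h4, if_true, if_false]
    field_simp
    ring
  · omega

theorem stepMatrix_pow_mulVec {P : PhysicalEmbedding (monteCarloMachine M init T)}
    (hP : P.IsAdiabatic) (F : ℕ → (Fin (r + 1) → Bool) → ℝ) (n : ℕ) :
    (P.stepMatrix ^ n).mulVec (fun p => ofLayerBits F p.1.1 + ofLayerBits F p.1.2) =
      fun p => ofLayerBits ((layerStep (2 * T + 2 * r + 1))^[n] F) p.1.1 +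
        ofLayerBits ((layerStep (2 * T + 2 * r + 1))^[n] F) p.1.2 := by
  induction n with
  | zero => simp
  | succ n ih =>
    rw [pow_succ', ← Matrix.mulVec_mulVec, ih, Function.iterate_succ_apply',
      show (fun p : PairNode r T => ofLayerBits ((layerStep (2 * T + 2 * r + 1))^[n] F) p.1.1 +
        ofLayerBits ((layerStep (2 * T + 2 * r + 1))^[n] F) p.1.2) =
        (fun p => ofLayerBits ((layerStep (2 * T + 2 * r + 1))^[n] F) p.1.1) +
        fun p => ofLayerBits ((layerStep (2 * T + 2 * r + 1))^[n] F) p.1.2 from rfl,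
      Matrix.mulVec_add, stepMatrix_mulVec_fst hP, stepMatrix_mulVec_snd hP]
    rfl

theorem stepMatrix_mulVec_one {C W Mt O : Type*} {M : GeneralMachine C W Mt O} [Fintype C]
    [DecidableEq C] (P : PhysicalEmbedding M) : P.stepMatrix.mulVec 1 = 1 := by
  ext u
  simp [stepMatrix_mulVec]

/-- No exit rate exceeds `8k`, so the diagonal stays nonnegative; this is why that uniformization
rate is used. -/
theorem stepMatrix_nonneg {P : PhysicalEmbedding (monteCarloMachine M init T)}
    (hP : P.IsAdiabatic) (p q : PairNode r T) : 0 ≤ P.stepMatrix p q := by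
  have hk := P.rate_pos
  rw [stepMatrix, Matrix.add_apply, Matrix.smul_apply, smul_eq_mul, generator, Matrix.of_apply]
  by_cases h : p = q
  · subst h
    rw [Matrix.one_apply_eq, if_pos rfl, sum_jumpRate hP]
    have hle : P.rate * ((if layer p.1.1 < 2 * T + 2 * r + 1 then (4 : ℝ) else 0) +
        if 0 < layer p.1.1 then 4 else 0) ≤ 8 * P.rate := by
      split_ifs <;> linarith
    have := mul_le_mul_of_nonneg_left hle (show 0 ≤ (8 * P.rate)⁻¹ by positivity)
    rw [inv_mul_cancel₀ (by positivity)] at this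
    linarith
  · rw [Matrix.one_apply_ne h, if_neg h, zero_add]
    exact mul_nonneg (by positivity) (jumpRate_nonneg P p q)

end PhysicalEmbedding

end JumpChain

/-! ### Exponentials of nonnegative matrices -/

namespace Matrix

variable {C : Type*} [Fintype C]

theorem mulVec_nonneg {A : Matrix C C ℝ} (hA : ∀ x y, 0 ≤ A x y) {φ : C → ℝ} (hφ : ∀ x, 0 ≤ φ x)
    (x : C) : 0 ≤ A.mulVec φ x :=
  Finset.sum_nonneg fun y _ => mul_nonneg (hA x y) (hφ y)

variable [DecidableEq C]

theorem hasSum_exp_smul_mulVec (A : Matrix C C ℝ) (s : ℝ) (φ : C → ℝ) (x : C) :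
    HasSum (fun n : ℕ => s ^ n / n.factorial * (A ^ n).mulVec φ x)
      ((NormedSpace.exp (s • A)).mulVec φ x) := by
  let _ : NormedRing (Matrix C C ℝ) := Matrix.linftyOpNormedRing
  let _ : NormedAlgebra ℝ (Matrix C C ℝ) := Matrix.linftyOpNormedAlgebra
  have h : HasSum (fun n : ℕ => ((n.factorial : ℝ)⁻¹) • (s • A) ^ n) (NormedSpace.exp (s • A)) :=
    NormedSpace.exp_series_hasSum_exp' (𝕂 := ℝ) (s • A)
  let ℓ : Matrix C C ℝ →ₗ[ℝ] ℝ :=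
    { toFun := fun B => B.mulVec φ x
      map_add' := fun B B' => by rw [Matrix.add_mulVec]; rfl
      map_smul' := fun a B => by rw [Matrix.smul_mulVec]; rfl }
  have h' := h.map ℓ (LinearMap.continuous_of_finiteDimensional ℓ)
  refine h'.congr_fun ?_
  intro n
  simp only [Function.comp_apply, map_smul, smul_pow, smul_eq_mul]
  change _ = _ * (_ * (A ^ n).mulVec φ x)
  ring

theorem pow_mulVec_nonneg {A : Matrix C C ℝ} (hA : ∀ x y, 0 ≤ A x y) {φ : C → ℝ}
    (hφ : ∀ x, 0 ≤ φ x) (n : ℕ) (x : C) : 0 ≤ (A ^ n).mulVec φ x := by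
  induction n generalizing x with
  | zero => simpa using hφ x
  | succ n ih =>
    rw [pow_succ', ← Matrix.mulVec_mulVec]
    exact mulVec_nonneg hA ih x

theorem exp_smul_nonneg {A : Matrix C C ℝ} (hA : ∀ x y, 0 ≤ A x y) {s : ℝ} (hs : 0 ≤ s)
    (x y : C) : 0 ≤ NormedSpace.exp (s • A) x y := by
  have h := hasSum_exp_smul_mulVec A s (Pi.single y 1) x
  rw [Matrix.mulVec_single_one, Matrix.col_apply] at h
  refine h.nonneg fun n => mul_nonneg (by positivity) (pow_mulVec_nonneg hA (fun z => ?_) n x)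
  rw [Pi.single_apply]
  split_ifs <;> norm_num

theorem abs_exp_smul_mulVec_le {A : Matrix C C ℝ} {s : ℝ} (hs : 0 ≤ s) {φ : C → ℝ} {x : C}
    {K ρ : ℝ} (h : ∀ n, |(A ^ n).mulVec φ x| ≤ K * ρ ^ n) :
    |(NormedSpace.exp (s • A)).mulVec φ x| ≤ K * Real.exp (s * ρ) := by
  have hexp : HasSum (fun n : ℕ => K * ((s * ρ) ^ n / n.factorial)) (K * Real.exp (s * ρ)) := by
    rw [Real.exp_eq_exp_ℝ]
    exact (NormedSpace.expSeries_div_hasSum_exp (s * ρ)).mul_left K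
  refine (hasSum_exp_smul_mulVec A s φ x).norm_le_of_bounded hexp fun n => ?_
  rw [Real.norm_eq_abs, abs_mul, abs_of_nonneg (by positivity), mul_pow]
  have := mul_le_mul_of_nonneg_left (h n) (show 0 ≤ s ^ n / (n.factorial : ℝ) by positivity)
  calc _ ≤ _ := this
    _ = _ := by ring

theorem exp_smul_mulVec_one {A : Matrix C C ℝ} (hA : A.mulVec 1 = 1) (s : ℝ) :
    (NormedSpace.exp (s • A)).mulVec 1 = fun _ => Real.exp s := by
  have hpow : ∀ n, (A ^ n).mulVec 1 = 1 := fun n => by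
    induction n with
    | zero => simp
    | succ n ih => rw [pow_succ', ← Matrix.mulVec_mulVec, ih, hA]
  ext x
  have h := hasSum_exp_smul_mulVec A s 1 x
  simp only [hpow, Pi.one_apply, mul_one] at h
  refine h.unique ?_
  rw [Real.exp_eq_exp_ℝ]
  exact NormedSpace.expSeries_div_hasSum_exp s

end Matrix

/-! ### Conditional laws of the recorded values -/

namespace PhysicalEmbedding

section Observations

variable {C W Y : Type*} [Fintype C] [DecidableEq C]
  {M : GeneralMachine C W (Fin 2) (Option Y × Option Y)} (P : PhysicalEmbedding M)

theorem pathProb_snoc (x₀ : C) (wait : ℕ → ℝ) (n : ℕ) (x : Fin n → C) (z : C) :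
    P.pathProb x₀ wait (n + 1) (Fin.snoc x z : Fin (n + 1) → C) =
      P.pathProb x₀ wait n x *
        P.transition (wait n) ((Fin.cons x₀ x : Fin (n + 1) → C) (Fin.last n)) z := by
  rw [pathProb, Fin.prod_univ_castSucc, Fin.cons_snoc_eq_snoc_cons]
  simp only [Fin.snoc_castSucc, Fin.snoc_last, Fin.val_castSucc, Fin.val_last]
  rfl

theorem pathProb_nonneg {wait : ℕ → ℝ} (hwait : ∀ i x y, 0 ≤ P.transition (wait i) x y) (x₀ : C)
    (n : ℕ) (x : Fin n → C) : 0 ≤ P.pathProb x₀ wait n x :=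
  Finset.prod_nonneg fun _ _ => hwait _ _ _

open Classical in
-- The Markov property: the new record depends on the past only through the configuration seen last.
theorem outputsProb_snoc (x₀ : C) (wait : ℕ → ℝ) (n : ℕ) (y : Fin n → Option Y) (o : Option Y) :
    P.outputsProb x₀ wait (n + 1) (Fin.snoc y o : Fin (n + 1) → Option Y) =
      ∑ x : Fin n → C, (if ∀ i, M.recorded (x i) = y i then P.pathProb x₀ wait n x else 0) *
        (P.transition (wait n)).mulVec (fun z => if M.recorded z = o then 1 else 0)
          ((Fin.cons x₀ x : Fin (n + 1) → C) (Fin.last n)) := by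
  rw [outputsProb, ← (Fin.snocEquiv fun _ : Fin (n + 1) => C).sum_comp, Fintype.sum_prod_type_right]
  refine Finset.sum_congr rfl fun x _ => ?_
  rw [Matrix.mulVec, dotProduct, Finset.mul_sum]
  refine Finset.sum_congr rfl fun z _ => ?_
  have h : (Fin.snocEquiv fun _ : Fin (n + 1) => C) (z, x) = (Fin.snoc x z : Fin (n + 1) → C) := rfl
  rw [h, pathProb_snoc]
  simp only [Fin.forall_fin_succ', Fin.snoc_castSucc, Fin.snoc_last]
  by_cases h1 : ∀ i, M.recorded (x i) = y i <;> by_cases h2 : M.recorded z = o <;> simp [h1, h2]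

open Classical in
theorem sum_mul_outputsProb_snoc [Fintype Y] (x₀ : C) (wait : ℕ → ℝ) (n : ℕ)
    (y : Fin n → Option Y) (h : Option Y → ℝ) :
    ∑ o, h o * P.outputsProb x₀ wait (n + 1) (Fin.snoc y o : Fin (n + 1) → Option Y) =
      ∑ x : Fin n → C, (if ∀ i, M.recorded (x i) = y i then P.pathProb x₀ wait n x else 0) *
        (P.transition (wait n)).mulVec (fun z => h (M.recorded z))
          ((Fin.cons x₀ x : Fin (n + 1) → C) (Fin.last n)) := by
  simp only [outputsProb_snoc, Finset.mul_sum]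
  rw [Finset.sum_comm]
  refine Finset.sum_congr rfl fun x _ => ?_
  simp only [Matrix.mulVec, dotProduct]
  rw [Finset.mul_sum]
  simp only [Finset.mul_sum]
  rw [Finset.sum_comm]
  refine Finset.sum_congr rfl fun z _ => ?_
  rw [Finset.sum_eq_single (M.recorded z) (fun o _ ho => by simp [ho.symm]) (by simp)]
  simp only [if_true]
  ring

/-- If, from every configuration, the law of the value recorded after the last waiting time is close
to `q` when tested against functions bounded by `1`, then so is the conditional law. -/
theorem tvDist_nextOutputProb_le [Fintype Y] {x₀ : C} {wait : ℕ → ℝ} {n : ℕ}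
    {y : Fin n → Option Y} (hwait : ∀ i u v, 0 ≤ P.transition (wait i) u v)
    (hpos : 0 < P.outputsProb x₀ wait n y) {q : Option Y → ℝ} {ε : ℝ}
    (hq : ∀ h : Option Y → ℝ, (∀ o, |h o| ≤ 1) → ∀ u,
      |(P.transition (wait n)).mulVec (fun z => h (M.recorded z)) u - ∑ o, h o * q o| ≤ 2 * ε) :
    tvDist q (P.nextOutputProb x₀ wait n y) ≤ ε := by
  classical
  set Z := P.outputsProb x₀ wait n y with hZ
  -- The sign function at which the `ℓ¹` distance is attained as a difference of expectations.
  set h : Option Y → ℝ := fun o => if P.nextOutputProb x₀ wait n y o ≤ q o then -1 else 1 with hh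
  have habs : ∀ o, |h o| ≤ 1 := fun o => by
    simp only [hh]
    split_ifs <;> simp
  have h1 : ∑ o, |q o - P.nextOutputProb x₀ wait n y o| =
      ∑ o, h o * P.nextOutputProb x₀ wait n y o - ∑ o, h o * q o := by
    rw [← Finset.sum_sub_distrib]
    refine Finset.sum_congr rfl fun o _ => ?_
    simp only [hh]
    split_ifs with ho
    · rw [abs_of_nonneg (by linarith)]
      ring
    · rw [abs_of_neg (by linarith)]
      ring
  have h2 : (∑ o, h o * P.nextOutputProb x₀ wait n y o) * Z =
      ∑ x : Fin n → C, (if ∀ i, M.recorded (x i) = y i then P.pathProb x₀ wait n x else 0) *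
        (P.transition (wait n)).mulVec (fun z => h (M.recorded z))
          ((Fin.cons x₀ x : Fin (n + 1) → C) (Fin.last n)) := by
    rw [← sum_mul_outputsProb_snoc, Finset.sum_mul]
    refine Finset.sum_congr rfl fun o _ => ?_
    rw [nextOutputProb, mul_assoc, div_mul_cancel₀ _ hpos.ne']
  have h3 : (∑ o, h o * P.nextOutputProb x₀ wait n y o) * Z ≤
      (∑ o, h o * q o + 2 * ε) * Z := by
    rw [h2, hZ, outputsProb, Finset.mul_sum]
    refine Finset.sum_le_sum fun x _ => ?_
    rw [mul_comm]
    refine mul_le_mul_of_nonneg_right ?_ ?_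
    · linarith [(abs_le.1 (hq h habs ((Fin.cons x₀ x : Fin (n + 1) → C) (Fin.last n)))).2]
    · split_ifs
      · exact P.pathProb_nonneg hwait _ _ _
      · exact le_rfl
  have h4 := le_of_mul_le_mul_right h3 hpos
  rw [tvDist, h1]
  linarith

end Observations

/-! ### Relaxation of the product machine -/

section Relaxation

open SubNode PairNode

variable {C W Mt Y : Type*} {r T : ℕ} {M : GeneralMachine C W Mt (Option Y)}
  {init : (Fin r → Bool) → C}

theorem transition_nonneg {P : PhysicalEmbedding (monteCarloMachine M init T)}
    (hP : P.IsAdiabatic) {t : ℝ} (ht : 0 ≤ t) (p q : PairNode r T) : 0 ≤ P.transition t p q := by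
  have hk := P.rate_pos
  rw [transition_eq, Matrix.smul_apply, smul_eq_mul]
  exact mul_nonneg (Real.exp_nonneg _)
    (Matrix.exp_smul_nonneg (stepMatrix_nonneg hP) (by positivity) p q)

theorem transition_mulVec_one {C W Mt O : Type*} {M : GeneralMachine C W Mt O} [Fintype C]
    [DecidableEq C] (P : PhysicalEmbedding M) (t : ℝ) : (P.transition t).mulVec 1 = 1 := by
  rw [transition_eq, Matrix.smul_mulVec, Matrix.exp_smul_mulVec_one P.stepMatrix_mulVec_one]
  ext x
  simp [← Real.exp_add]

theorem abs_transition_mulVec_le {P : PhysicalEmbedding (monteCarloMachine M init T)}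
    (hP : P.IsAdiabatic) {F : ℕ → (Fin (r + 1) → Bool) → ℝ} {K : ℝ} (hK : 0 ≤ K)
    (hF : ∀ i ≤ 2 * T + 2 * r + 1, ‖F i‖ ≤ K)
    (hF0 : ∀ i ≤ 2 * T + 2 * r + 1, tailAvg r (F i) = 0) {t : ℝ} (ht : 0 ≤ t)
    (p : PairNode r T) :
    |(P.transition t).mulVec (fun q => ofLayerBits F q.1.1 + ofLayerBits F q.1.2) p| ≤
      6 * K * Real.exp (-(8 * P.rate * t / (3 * (2 * T + 2 * r + 2) ^ 2))) := by
  have hk := P.rate_pos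
  set ρ := decayFactor (((2 * T + 2 * r + 1 : ℕ) : ℝ) + 1) with hρ
  have hpow : ∀ n, |(P.stepMatrix ^ n).mulVec
      (fun q => ofLayerBits F q.1.1 + ofLayerBits F q.1.2) p| ≤ 6 * K * ρ ^ n := fun n => by
    rw [stepMatrix_pow_mulVec hP]
    have hx : ∀ x : SubNode r T,
        |ofLayerBits ((layerStep (2 * T + 2 * r + 1))^[n] F) x| ≤ 3 * K * ρ ^ n := fun x =>
      (norm_le_pi_norm ((layerStep (2 * T + 2 * r + 1))^[n] F (layer x)) (bits x)).trans
        (norm_iterate_layerStep_le (by omega) hK hF hF0 n (layer_le x))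
    refine (abs_add_le _ _).trans ?_
    linarith [hx p.1.1, hx p.1.2]
  have h := Matrix.abs_exp_smul_mulVec_le (s := 8 * P.rate * t) (by positivity) hpow
  rw [transition_eq, Matrix.smul_mulVec, Pi.smul_apply, smul_eq_mul, abs_mul,
    abs_of_nonneg (Real.exp_nonneg _)]
  refine (mul_le_mul_of_nonneg_left h (Real.exp_nonneg _)).trans (le_of_eq ?_)
  -- With `s = 8kt` the exponents combine to `-s + sρ = -s / (3N²)`.
  rw [mul_left_comm, ← Real.exp_add]
  congr 2
  rw [hρ, decayFactor]
  push_cast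
  field_simp
  ring

end Relaxation

end PhysicalEmbedding

/-! ### The recorded values of the product machine -/

theorem GeneralMachine.run_eq_of_isTerminal {C W Mt O : Type*} (M : GeneralMachine C W Mt O) {x : C}
    {n : ℕ} (h : M.IsTerminal (M.run x n)) {t : ℕ} (hnt : n ≤ t) : M.run x t = M.run x n := by
  induction t, hnt using Nat.le_induction with
  | base => rfl
  | succ t _ ih =>
    rw [GeneralMachine.run, Function.iterate_succ_apply']
    change M.advance (M.run x t) = _
    rw [ih, GeneralMachine.advance, dif_neg]
    rw [h]
    exact Set.not_nonempty_empty

theorem GeneralMachine.ComputesWithin.out_run {C W Mt Y : Type*}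
    {M : GeneralMachine C W Mt (Option Y)} {r T : ℕ} {init : (Fin r → Bool) → C}
    {g : (Fin r → Bool) → Y} (hM : M.ComputesWithin init g T) (b : Fin r → Bool) {t : ℕ}
    (ht : T ≤ t) : M.out (M.run (init b) t) = some (g b) := by
  obtain ⟨n, hn, hterm, hout⟩ := hM b
  rw [M.run_eq_of_isTerminal hterm (by omega), hout]

section Recorded

open SubNode

variable {C W Mt Y : Type*} {r T : ℕ} {M : GeneralMachine C W Mt (Option Y)}
  {init : (Fin r → Bool) → C} {g : (Fin r → Bool) → Y}

open Classical in
theorem metadataSum_eq (M : GeneralMachine C W Mt (Option Y)) (init : (Fin r → Bool) → C)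
    (p : PairNode r T) : metadataSum M init T p = if IsHolding p.1.1 then 1 else -1 := by
  have h := p.2
  rw [metadataSum]
  by_cases h1 : IsHolding p.1.1
  · have h2 : ¬ IsHolding p.1.2 := by
      rw [IsHolding] at *
      omega
    simp [subMachine, h1, h2]
  · have h2 : IsHolding p.1.2 := by
      rw [IsHolding] at *
      omega
    simp [subMachine, h1, h2]

theorem out_subMachine_of_isHolding (hM : M.ComputesWithin init g T) (s : ℤ) {x : SubNode r T}
    (hx : IsHolding x) : (subMachine M init T s).out x = some (g (Fin.init (bits x))) := by
  rcases x with ⟨i, u⟩ | ⟨b, a, t⟩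
  · have := i.2
    simp only [IsHolding, layer] at hx
    omega
  · simp only [IsHolding, layer] at hx
    have hb : Fin.init (bits (.inr (b, a, t) : SubNode r T)) = b := Fin.init_snoc _ _
    rw [hb]
    exact hM.out_run b (by omega)

/-- The mean of a function of the output of `g` over uniformly random strings. -/
noncomputable def uniformMean (g : (Fin r → Bool) → Y) (h : Option Y → ℝ) : ℝ :=
  (∑ b, h (some (g b))) / 2 ^ r

/-- The deviation from its mean of a function of the output, on the holding region. -/
noncomputable def holdingDeviation (T : ℕ) (g : (Fin r → Bool) → Y) (h : Option Y → ℝ) (i : ℕ)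
    (u : Fin (r + 1) → Bool) : ℝ :=
  if r + 1 + T ≤ i then h (some (g (Fin.init u))) - uniformMean g h else 0

theorem apply_recorded_sub_uniformMean (hM : M.ComputesWithin init g T) (h : Option Y → ℝ)
    (p : PairNode r T) :
    h ((monteCarloMachine M init T).recorded p) - uniformMean g h =
      ofLayerBits (holdingDeviation T g h) p.1.1 + ofLayerBits (holdingDeviation T g h) p.1.2 := by
  have hp := p.2
  by_cases h1 : IsHolding p.1.1
  · have h2 : ¬ IsHolding p.1.2 := by
      rw [IsHolding] at *
      omega
    have hrec : (monteCarloMachine M init T).recorded p = some (g (Fin.init (bits p.1.1))) := by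
      rw [← out_subMachine_of_isHolding hM 1 h1]
      simp [GeneralMachine.recorded, monteCarloMachine, metadataSum_eq, h1]
    rw [IsHolding] at h1 h2
    simp [hrec, ofLayerBits, holdingDeviation, h1, h2]
  · have h2 : IsHolding p.1.2 := by
      rw [IsHolding] at *
      omega
    have hrec : (monteCarloMachine M init T).recorded p = some (g (Fin.init (bits p.1.2))) := by
      rw [← out_subMachine_of_isHolding hM (-1) h2]
      simp [GeneralMachine.recorded, monteCarloMachine, metadataSum_eq, h1]
    rw [IsHolding] at h1 h2
    simp [hrec, ofLayerBits, holdingDeviation, h1, h2]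

theorem abs_uniformMean_le (g : (Fin r → Bool) → Y) {h : Option Y → ℝ} (hh : ∀ o, |h o| ≤ 1) :
    |uniformMean g h| ≤ 1 := by
  rw [uniformMean, abs_div, abs_of_pos (show (0 : ℝ) < 2 ^ r by positivity),
    div_le_one (by positivity)]
  refine (Finset.abs_sum_le_sum_abs _ _).trans ((Finset.sum_le_sum fun b _ => hh _).trans ?_)
  simp

theorem norm_holdingDeviation_le (T : ℕ) (g : (Fin r → Bool) → Y) {h : Option Y → ℝ}
    (hh : ∀ o, |h o| ≤ 1) (i : ℕ) : ‖holdingDeviation T g h i‖ ≤ 2 := by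
  refine (pi_norm_le_iff_of_nonneg (by norm_num)).2 fun u => ?_
  rw [holdingDeviation]
  split_ifs
  · have h1 := hh (some (g (Fin.init u)))
    have h2 := abs_uniformMean_le g hh
    exact (abs_sub _ _).trans (by linarith)
  · simp

theorem sum_comp_init (H : (Fin r → Bool) → ℝ) :
    ∑ u : Fin (r + 1) → Bool, H (Fin.init u) = 2 * ∑ b, H b := by
  rw [← (Fin.snocEquiv fun _ : Fin (r + 1) => Bool).sum_comp, Fintype.sum_prod_type]
  have h : ∀ z : Bool × (Fin r → Bool),
      Fin.init ((Fin.snocEquiv fun _ : Fin (r + 1) => Bool) z) = z.2 := fun z =>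
    Fin.init_snoc (α := fun _ => Bool) _ _
  simp [h]

/-- Outputs ignore the copy bit, and centring makes the sum over inputs vanish; outside the holding
region the function is zero. -/
theorem tailAvg_holdingDeviation (T : ℕ) (g : (Fin r → Bool) → Y) (h : Option Y → ℝ) (i : ℕ) :
    tailAvg r (holdingDeviation T g h i) = 0 := by
  have hlast : bitIndex r r = Fin.last r := Fin.ext (by simp [bitIndex])
  refine tailAvg_eq_zero (bitAvg_eq_self_of_update fun u c => ?_) ?_
  · rw [holdingDeviation, holdingDeviation, hlast, Fin.init_update_last]
  · simp only [holdingDeviation]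
    split_ifs
    · rw [sum_comp_init fun b => h (some (g b)) - uniformMean g h, Finset.sum_sub_distrib]
      simp [uniformMean]
      field_simp
      ring
    · simp

theorem sum_mul_registerLaw [Fintype Y] {D : PMF Y} (hg : IsGenerator g D) (h : Option Y → ℝ) :
    ∑ o, h o * registerLaw D o = uniformMean g h := by
  classical
  have hD : ∀ y, (D y).toReal = ∑ b, if y = g b then ((2 : ℝ) ^ r)⁻¹ else 0 := fun y => by
    rw [← hg, PMF.map_apply, tsum_fintype, ENNReal.toReal_sum]
    · refine Finset.sum_congr rfl fun b _ => ?_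
      by_cases hy : y = g b <;> simp [hy]
    · intro b _
      by_cases hy : y = g b <;> simp [hy]
  rw [Fintype.sum_option]
  simp only [registerLaw, hD, Finset.mul_sum, mul_zero, zero_add]
  rw [Finset.sum_comm, uniformMean, Finset.sum_div]
  refine Finset.sum_congr rfl fun b _ => ?_
  simp [div_eq_mul_inv]

/-- The constant is `12 = 2 · 3 · 2`: two coordinates, the supersolution bound `3`, and deviations
of size at most `2`. -/
theorem abs_transition_mulVec_recorded_sub_le (hM : M.ComputesWithin init g T)
    {P : PhysicalEmbedding (monteCarloMachine M init T)} (hP : P.IsAdiabatic) {h : Option Y → ℝ}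
    (hh : ∀ o, |h o| ≤ 1) {t : ℝ} (ht : 0 ≤ t) (p : PairNode r T) :
    |(P.transition t).mulVec (fun q => h ((monteCarloMachine M init T).recorded q)) p -
      uniformMean g h| ≤ 12 * Real.exp (-(8 * P.rate * t / (3 * (2 * T + 2 * r + 2) ^ 2))) := by
  have hle := PhysicalEmbedding.abs_transition_mulVec_le hP (F := holdingDeviation T g h) (K := 2)
    (by norm_num) (fun i _ => norm_holdingDeviation_le T g hh i)
    (fun i _ => tailAvg_holdingDeviation T g h i) ht p
  have hfun : (fun q => h ((monteCarloMachine M init T).recorded q)) =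
      (fun q : PairNode r T => ofLayerBits (holdingDeviation T g h) q.1.1 +
        ofLayerBits (holdingDeviation T g h) q.1.2) + uniformMean g h • (1 : PairNode r T → ℝ) := by
    ext q
    have := apply_recorded_sub_uniformMean hM h q
    simp only [Pi.add_apply, Pi.smul_apply, Pi.one_apply, smul_eq_mul, mul_one]
    linarith
  rw [hfun, Matrix.mulVec_add, Matrix.mulVec_smul, P.transition_mulVec_one]
  simp only [Pi.add_apply, Pi.smul_apply, Pi.one_apply, smul_eq_mul, mul_one, add_sub_cancel_right]
  exact hle.trans (le_of_eq (by norm_num))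

end Recorded

/-! ### Choice of the constants and conclusion -/

theorem six_mul_exp_neg_le {c : ℝ} (hc : 1 ≤ c) : 6 * Real.exp (-(4 * c)) ≤ (1 / 2 : ℝ) ^ c := by
  have h2 : (2 : ℝ) ≤ Real.exp 1 := by linarith [Real.add_one_le_exp (1 : ℝ)]
  have h1 : Real.exp (-1) ≤ 1 / 2 := by
    rw [Real.exp_neg, ← one_div]
    exact one_div_le_one_div_of_le (by norm_num) h2
  have h3 : Real.exp (-(3 * c)) ≤ 1 / 8 := by
    have h : Real.exp (-(3 * c)) ≤ Real.exp (-1) ^ 3 := by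
      rw [← Real.exp_nat_mul]
      exact Real.exp_le_exp.2 (by push_cast; linarith)
    exact h.trans ((pow_le_pow_left₀ (Real.exp_nonneg _) h1 3).trans (by norm_num))
  have h4 : Real.exp (-c) ≤ (1 / 2 : ℝ) ^ c := by
    have := Real.rpow_le_rpow (Real.exp_nonneg _) h1 (show 0 ≤ c by linarith)
    rwa [← Real.exp_mul, neg_one_mul] at this
  rw [show -(4 * c) = -(3 * c) + -c by ring, Real.exp_add]
  have h0 := Real.exp_nonneg (-c)
  nlinarith

theorem mainTheorem2 :
    ∃ (a b : ℝ) (τ : ℕ → ℕ → ℝ), 0 < a ∧ 0 < b ∧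
      (∀ T r : ℕ, a * ((T : ℝ) ^ 2 + (r : ℝ) ^ 2) ≤ τ T r ∧
        τ T r ≤ b * ((T : ℝ) ^ 2 + (r : ℝ) ^ 2)) ∧
      ∀ (C W Mt Y : Type*) [Fintype C] [Fintype Y]
        (M : GeneralMachine C W Mt (Option Y)) (r T : ℕ)
        (init : (Fin r → Bool) → C) (g : (Fin r → Bool) → Y) (D : PMF Y),
        M.IsReversible → IsGenerator g D → M.ComputesWithin init g T →
        (∀ p : PairNode r T, metadataSum M init T p = 1 ∨ metadataSum M init T p = -1) ∧
        (∃ P : PhysicalEmbedding (monteCarloMachine M init T), P.IsAdiabatic) ∧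
        ∀ P : PhysicalEmbedding (monteCarloMachine M init T), P.IsAdiabatic →
          P.IsEfficientMonteCarloSampler D (τ T r / P.rate) (1 / 2) := by
  refine ⟨48, 48, fun T r => 48 * ((T : ℝ) ^ 2 + (r : ℝ) ^ 2), by norm_num, by norm_num,
    fun T r => ⟨le_rfl, le_rfl⟩, ?_⟩
  intro C W Mt Y _ _ M r T init g D _ hg hM
  refine ⟨fun p => ?_, ⟨⟨fun _ => 0, 1, one_pos, 1, one_pos⟩, fun _ _ => rfl⟩, ?_⟩
  · rw [metadataSum_eq]
    split_ifs <;> simp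
  · intro P hP x₀ c n y hc hcn hpos
    have hk := P.rate_pos
    -- A halting chain has at least one node; `T ≥ 1` absorbs the additive `2` in the number of
    -- layers.
    have hT : (1 : ℝ) ≤ T := by
      obtain ⟨m, hm, -⟩ := hM fun _ => false
      exact_mod_cast (show 1 ≤ T by omega)
    have hr : (0 : ℝ) ≤ r := Nat.cast_nonneg r
    have hwait : ∀ i, 0 ≤ c i * (48 * ((T : ℝ) ^ 2 + (r : ℝ) ^ 2) / P.rate) := fun i =>
      mul_nonneg (hc i).le (by positivity)
    refine (P.tvDist_nextOutputProb_le
      (fun i => PhysicalEmbedding.transition_nonneg hP (hwait i)) hpos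
      -- Half of the constant `12`, because total variation is half of the `ℓ¹` distance.
      (ε := 6 * Real.exp (-(4 * c n))) fun h hh u => ?_).trans (six_mul_exp_neg_le hcn)
    rw [sum_mul_registerLaw hg]
    refine (abs_transition_mulVec_recorded_sub_le hM hP hh (hwait n) u).trans ?_
    have hexp : 4 * c n ≤ 8 * P.rate * (c n * (48 * ((T : ℝ) ^ 2 + (r : ℝ) ^ 2) / P.rate)) /
        (3 * (2 * T + 2 * r + 2) ^ 2) := by
      have hN : (2 * (T : ℝ) + 2 * r + 2) ^ 2 ≤ 32 * ((T : ℝ) ^ 2 + (r : ℝ) ^ 2) := by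
        nlinarith [sq_nonneg ((T : ℝ) - r)]
      rw [le_div_iff₀ (by positivity)]
      have h1 : 8 * P.rate * (c n * (48 * ((T : ℝ) ^ 2 + (r : ℝ) ^ 2) / P.rate)) =
          12 * c n * (32 * ((T : ℝ) ^ 2 + (r : ℝ) ^ 2)) := by
        field_simp
        ring
      rw [h1]
      have := mul_le_mul_of_nonneg_left hN (show 0 ≤ 12 * c n by linarith)
      linarith
    have := Real.exp_le_exp.2 (neg_le_neg hexp)
    linarith
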